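/- Let $d\ge 0$ be an integer, let $C$ be a real symmetric positive semidefinite $d\times d$ matrix, and let $\xi$ be a random vector with the (possibly degenerate) centred normal distribution $\mathcal N_d(0,C)$. Put $B=2\operatorname{tr}(C)$ and $\Sigma_2=\operatorname{tr}(C)\,C+C^2$. Write $\preceq$ for the Loewner order ($M\preceq N$ means that $N-M$ is positive semidefinite), and let the expectation of a random matrix be taken entrywise. Then for every integer $p\ge 2$ the entries of $(\xi\xi^{\mathsf T})^p$, $(\xi\xi^{\mathsf T}-C)^p$ and $(C-\xi\xi^{\mathsf T})^p$ are integrable, and $$\mathbb E\,(\xi\xi^{\mathsf T})^p\preceq \frac{p!}{2}\,B^{p-2}\bigl(\operatorname{tr}(C)\,C+2C^2\bigr),$$ $$\mathbb E\,(\xi\xi^{\mathsf T}-C)^p\preceq \frac{p!}{2}\,B^{p-2}\,\Sigma_2,$$ $$\mathbb E\,(C-\xi\xi^{\mathsf T})^p\preceq \frac{p!}{2}\,B^{p-2}\,\Sigma_2,$$ with the convention $0^0=1$. -/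

import Mathlib

open MeasureTheory ProbabilityTheory
open scoped MatrixOrder Nat

/-- A random real matrix is integrable when each of its entries is. -/
def MatrixIntegrable {Ω : Type*} [MeasurableSpace Ω] {d : ℕ}
    (M : Ω → Matrix (Fin d) (Fin d) ℝ) (P : Measure Ω) : Prop :=
  ∀ i j, Integrable (fun ω => M ω i j) P

/-- The expectation of a random real matrix, taken entry by entry. -/
noncomputable def matrixExpectation {Ω : Type*} [MeasurableSpace Ω] {d : ℕ}
    (M : Ω → Matrix (Fin d) (Fin d) ℝ) (P : Measure Ω) : Matrix (Fin d) (Fin d) ℝ :=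
  Matrix.of fun i j => ∫ ω, M ω i j ∂P

/-- The rank-one matrix `x xᵀ`. -/
def outerSelf {d : ℕ} (x : EuclideanSpace ℝ (Fin d)) : Matrix (Fin d) (Fin d) ℝ :=
  Matrix.of fun i j => x i * x j

/-! Writing `C = U D Uᵀ` with `U` orthogonal and `D = diag v` gives `ξ` the law of `U y`, with
independent centred Gaussian coordinates `y i` of variance `v i`. All three expectations become
conjugates by `U`, and flipping the sign of one coordinate kills their off-diagonal entries
(`integral_pow_apply_of_ne`). Only scalar bounds on diagonal entries remain.

Let `t = tr C`. Since `(y yᵀ)^(k+2) = |y|^(2(k+1)) y yᵀ`, the first bound concerns `E y_j²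
|y|^(2(k+1))`; Gaussian integration by parts gives a recursion in `k` (`mixedMoment_succ_le`).

For `M = y yᵀ - D`, write `M^(k+2) = M M^k M`. From `M ≤ |y|²` and `-M ≤ t`, the middle factor is at
most `|y|^(2k)` for odd `k` and `|y|^(2k) + t^k` for even `k`, so the diagonal entry is controlled
by `(M²)_jj` times a scalar (`Matrix.IsHermitian.pow_add_two_apply_self_le`). The same moment
recursion bounds the expectation, and strictness of a factorial inequality absorbs the extra `t^k`.
-/

open scoped NNReal

/-! ### Gaussian integration by parts for polynomials. -/

lemma integrable_pow_gaussianReal (μ : ℝ) (v : ℝ≥0) (n : ℕ) :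
    Integrable (fun x => x ^ n) (gaussianReal μ v) := by
  have h : MemLp id (n : ℝ≥0) (gaussianReal μ v) := memLp_id_gaussianReal n
  refine (integrable_norm_iff (by fun_prop)).1 ?_
  simpa only [norm_pow, id] using MemLp.integrable_norm_pow' (p := n) (by simpa using! h)

/-- The density `g` satisfies `g' = -(x / v) g`, so this is integration by parts. The truncated `n -
1` is harmless at `n = 0`, where the factor `n` vanishes. -/
lemma integral_pow_succ_gaussianReal (v : ℝ≥0) (n : ℕ) :
    ∫ x, x ^ (n + 1) ∂gaussianReal 0 v = v * (n * ∫ x, x ^ (n - 1) ∂gaussianReal 0 v) := by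
  by_cases hv : v = 0
  · simp [hv]
  have hv' : (v : ℝ) ≠ 0 := by exact_mod_cast hv
  have hint (m : ℕ) : Integrable (fun x => x ^ m * gaussianPDFReal 0 v x) := by
    have h := integrable_pow_gaussianReal 0 v m
    rw [gaussianReal_of_var_ne_zero _ hv, integrable_withDensity_iff_integrable_smul'
      (measurable_gaussianPDF 0 v) (by simp [gaussianPDF])] at h
    refine h.congr (Filter.Eventually.of_forall fun x => ?_)
    simp [toReal_gaussianPDF, mul_comm]
  have hderiv (x : ℝ) :
      HasDerivAt (gaussianPDFReal 0 v) (-(v : ℝ)⁻¹ * (x * gaussianPDFReal 0 v x)) x := by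
    have h1 : HasDerivAt (fun x : ℝ => -(x - 0) ^ 2 / (2 * v)) (-(x / v)) x := by
      refine (((((hasDerivAt_id' x).sub_const 0).fun_pow 2).fun_neg).div_const
        (2 * (v : ℝ))).congr_deriv ?_
      field_simp
      simp [mul_comm]
    have h2 := (h1.exp).const_mul (Real.sqrt (2 * Real.pi * v))⁻¹
    refine h2.congr_deriv ?_
    rw [gaussianPDFReal]; ring
  have key := integral_mul_deriv_eq_deriv_mul_of_integrable
    (u := fun x : ℝ => x ^ n) (v := gaussianPDFReal 0 v)
    (u' := fun x : ℝ => n * x ^ (n - 1))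
    (v' := fun x => -(v : ℝ)⁻¹ * (x * gaussianPDFReal 0 v x))
    (fun x _ => hasDerivAt_pow n x) (fun x _ => hderiv x)
    (((hint (n + 1)).const_mul (-(v : ℝ)⁻¹)).congr
      (Filter.Eventually.of_forall fun x => by simp only [Pi.mul_apply]; ring))
    (((hint (n - 1)).const_mul n).congr
      (Filter.Eventually.of_forall fun x => by simp only [Pi.mul_apply]; ring))
    ((hint n).congr (Filter.Eventually.of_forall fun x => by simp))
  rw [integral_gaussianReal_eq_integral_smul hv, integral_gaussianReal_eq_integral_smul hv]
  have e1 : ∫ x, x ^ n * (-(v : ℝ)⁻¹ * (x * gaussianPDFReal 0 v x)) =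
      -(v : ℝ)⁻¹ * ∫ x, gaussianPDFReal 0 v x • x ^ (n + 1) := by
    rw [← integral_const_mul]; congr 1; ext x; simp only [smul_eq_mul]; ring
  have e2 : ∫ x, n * x ^ (n - 1) * gaussianPDFReal 0 v x =
      n * ∫ x, gaussianPDFReal 0 v x • x ^ (n - 1) := by
    rw [← integral_const_mul]; congr 1; ext x; simp only [smul_eq_mul]; ring
  rw [e1, e2] at key
  field_simp at key
  linarith

/-- The centred Gaussian measure with independent coordinates of variances `v`. -/
noncomputable abbrev piGaussian {ι : Type*} [Fintype ι] (v : ι → ℝ≥0) : Measure (ι → ℝ) :=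
  Measure.pi fun i => gaussianReal 0 (v i)

open MvPolynomial in
lemma integrable_eval_piGaussian {ι : Type*} [Fintype ι] (v : ι → ℝ≥0) (f : MvPolynomial ι ℝ) :
    Integrable (fun y => eval y f) (piGaussian v) := by
  induction f using MvPolynomial.induction_on' with
  | monomial s a =>
    simp_rw [eval_monomial, Finsupp.prod_fintype _ _ (fun _ => pow_zero _)]
    exact (Integrable.fintype_prod fun i => integrable_pow_gaussianReal 0 (v i) (s i)).const_mul a
  | add p q hp hq => simp only [map_add]; exact hp.add hq

open MvPolynomial in
lemma integral_eval_monomial_piGaussian {ι : Type*} [Fintype ι] (v : ι → ℝ≥0)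
    (s : ι →₀ ℕ) (a : ℝ) :
    ∫ y, eval y (monomial s a) ∂piGaussian v =
      a * ∏ i, ∫ x, x ^ s i ∂gaussianReal 0 (v i) := by
  simp_rw [eval_monomial, Finsupp.prod_fintype _ _ (fun _ => pow_zero _)]
  rw [integral_const_mul, integral_fintype_prod_eq_prod (fun i (x : ℝ) => x ^ s i)]

open MvPolynomial in
/-- Gaussian integration by parts for polynomials. -/
lemma integral_X_mul_piGaussian {ι : Type*} [Fintype ι] (v : ι → ℝ≥0) (i : ι)
    (f : MvPolynomial ι ℝ) :
    ∫ y, y i * eval y f ∂piGaussian v = v i * ∫ y, eval y (pderiv i f) ∂piGaussian v := by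
  classical
  induction f using MvPolynomial.induction_on' with
  | monomial s a =>
    have h (y : ι → ℝ) : y i * eval y (monomial s a) =
        eval y (monomial (s + Finsupp.single i 1) a) := by
      rw [mul_comm, ← eval_X (f := y) i, ← map_mul, monomial_add_single, pow_one]
    simp_rw [h, pderiv_monomial, integral_eval_monomial_piGaussian]
    rw [← Finset.mul_prod_erase _ _ (Finset.mem_univ i),
      ← Finset.mul_prod_erase _ (fun j => ∫ x, x ^ (s - Finsupp.single i 1 : ι →₀ ℕ) j ∂gaussianReal 0 (v j))
        (Finset.mem_univ i)]
    have h1 : ∏ j ∈ Finset.univ.erase i,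
          ∫ x, x ^ (s + Finsupp.single i 1 : ι →₀ ℕ) j ∂gaussianReal 0 (v j) =
        ∏ j ∈ Finset.univ.erase i,
          ∫ x, x ^ (s - Finsupp.single i 1 : ι →₀ ℕ) j ∂gaussianReal 0 (v j) := by
      refine Finset.prod_congr rfl fun j hj => ?_
      have : i ≠ j := (Finset.ne_of_mem_erase hj).symm
      simp [this]
    rw [h1]
    simp only [Finsupp.add_apply, Finsupp.single_eq_same, Finsupp.tsub_apply,
      integral_pow_succ_gaussianReal]
    ring
  | add p q hp hq =>
    simp only [map_add, mul_add]
    rw [integral_add, integral_add, hp, hq, mul_add]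
    · exact integrable_eval_piGaussian v _
    · exact integrable_eval_piGaussian v _
    · exact (integrable_eval_piGaussian v (X i * p)).congr (by simp)
    · exact (integrable_eval_piGaussian v (X i * q)).congr (by simp)

open MvPolynomial in
/-- The expectation of a polynomial in independent centred Gaussian variables, as a linear map. -/
noncomputable def gaussianExpectation {ι : Type*} [Fintype ι] (v : ι → ℝ≥0) :
    MvPolynomial ι ℝ →ₗ[ℝ] ℝ where
  toFun f := ∫ y, eval y f ∂piGaussian v
  map_add' p q := by
    simp only [map_add]
    exact integral_add (integrable_eval_piGaussian v p) (integrable_eval_piGaussian v q)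
  map_smul' a p := by
    simp only [smul_eval, RingHom.id_apply, smul_eq_mul]
    exact integral_const_mul _ _

/-- The squared Euclidean norm as a polynomial. -/
noncomputable def sqNormPoly (ι : Type*) [Fintype ι] : MvPolynomial ι ℝ :=
  ∑ i, MvPolynomial.X i ^ 2

/-! ### Mixed moments and their factorial bounds. -/

section

open MvPolynomial

variable {ι : Type*} [Fintype ι] (v : ι → ℝ≥0)

lemma gaussianExpectation_apply (f : MvPolynomial ι ℝ) :
    gaussianExpectation v f = ∫ y, eval y f ∂piGaussian v := rfl

lemma gaussianExpectation_C (a : ℝ) : gaussianExpectation v (C a) = a := by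
  simp [gaussianExpectation_apply]

lemma gaussianExpectation_X_mul (i : ι) (f : MvPolynomial ι ℝ) :
    gaussianExpectation v (X i * f) = v i * gaussianExpectation v (pderiv i f) := by
  rw [gaussianExpectation_apply, gaussianExpectation_apply, ← integral_X_mul_piGaussian]
  simp

lemma gaussianExpectation_nonneg {f : MvPolynomial ι ℝ} (hf : ∀ y, 0 ≤ eval y f) :
    0 ≤ gaussianExpectation v f :=
  integral_nonneg hf

lemma gaussianExpectation_mono {f g : MvPolynomial ι ℝ} (h : ∀ y, eval y f ≤ eval y g) :
    gaussianExpectation v f ≤ gaussianExpectation v g :=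
  integral_mono (integrable_eval_piGaussian v f) (integrable_eval_piGaussian v g) h

@[simp]
lemma eval_sqNormPoly (y : ι → ℝ) : eval y (sqNormPoly ι) = ∑ i, y i ^ 2 := by
  simp [sqNormPoly]

lemma pderiv_sqNormPoly_pow (i : ι) (k : ℕ) :
    pderiv i (sqNormPoly ι ^ k) = C (2 * k : ℝ) * (X i * sqNormPoly ι ^ (k - 1)) := by
  classical
  have h : pderiv i (sqNormPoly ι) = 2 * X i := by
    simp only [sqNormPoly, map_sum, Derivation.leibniz_pow, pderiv_X]
    rw [Finset.sum_eq_single i] <;> simp +contextual [eq_comm]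
  rw [Derivation.leibniz_pow, h]
  simp only [nsmul_eq_mul, smul_eq_mul, map_mul, map_natCast, map_ofNat]
  ring

lemma gaussianExpectation_C_mul (a : ℝ) (f : MvPolynomial ι ℝ) :
    gaussianExpectation v (C a * f) = a * gaussianExpectation v f := by
  rw [← smul_eq_C_mul, map_smul, smul_eq_mul]

/-- The mixed moment of a squared coordinate and a power of the squared norm. -/
noncomputable def mixedMoment (j : ι) (k : ℕ) : ℝ :=
  gaussianExpectation v (X j ^ 2 * sqNormPoly ι ^ k)

lemma mixedMoment_nonneg (j : ι) (k : ℕ) : 0 ≤ mixedMoment v j k :=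
  gaussianExpectation_nonneg v fun y => by
    simp only [map_mul, map_pow, eval_X, eval_sqNormPoly]; positivity

/-- Integrating one factor `X j` by parts produces the left side plus a nonnegative term. -/
lemma mul_gaussianExpectation_sqNormPoly_pow_le (j : ι) (k : ℕ) :
    v j * gaussianExpectation v (sqNormPoly ι ^ k) ≤ mixedMoment v j k := by
  have h : mixedMoment v j k = v j * (gaussianExpectation v (sqNormPoly ι ^ k) +
      2 * k * mixedMoment v j (k - 1)) := by
    rw [mixedMoment, pow_two, mul_assoc, gaussianExpectation_X_mul, Derivation.leibniz,
      pderiv_sqNormPoly_pow, pderiv_X_self, mixedMoment]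
    simp only [smul_eq_mul, mul_one, map_add]
    rw [mul_left_comm, gaussianExpectation_C_mul, ← mul_assoc (X j), ← pow_two, add_comm]
  rw [h]
  have := mixedMoment_nonneg v j (k - 1)
  have : (0 : ℝ) ≤ v j := (v j).2
  gcongr
  have : 0 ≤ 2 * k * mixedMoment v j (k - 1) := by positivity
  linarith

lemma gaussianExpectation_X_sq_mul_mixed [DecidableEq ι] (i j : ι) (k : ℕ) :
    gaussianExpectation v (X i ^ 2 * (X j ^ 2 * sqNormPoly ι ^ k)) =
      v i * (mixedMoment v j k + (if i = j then 2 * mixedMoment v j k else 0) +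
        2 * k * gaussianExpectation v (X i ^ 2 * (X j ^ 2 * sqNormPoly ι ^ (k - 1)))) := by
  rw [pow_two (X i), mul_assoc, gaussianExpectation_X_mul]
  congr 1
  have h : pderiv i (X i * (X j ^ 2 * sqNormPoly ι ^ k)) =
      X j ^ 2 * sqNormPoly ι ^ k + (if i = j then C 2 * (X j ^ 2 * sqNormPoly ι ^ k) else 0) +
        C (2 * k : ℝ) * (X i ^ 2 * (X j ^ 2 * sqNormPoly ι ^ (k - 1))) := by
    rw [Derivation.leibniz, Derivation.leibniz, pderiv_sqNormPoly_pow, Derivation.leibniz_pow,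
      pderiv_X_self, pderiv_X]
    split_ifs with hij
    · subst hij
      simp only [smul_eq_mul, nsmul_eq_mul, Pi.single_eq_same, map_ofNat]
      push_cast
      ring
    · simp only [smul_eq_mul, nsmul_eq_mul, Pi.single_eq_of_ne (Ne.symm hij)]
      ring
  rw [h, map_add, map_add, gaussianExpectation_C_mul, ← pow_two]
  split_ifs
  · rw [gaussianExpectation_C_mul]; rfl
  · rw [map_zero]; rfl

lemma mixedMoment_zero (j : ι) : mixedMoment v j 0 = v j := by
  rw [mixedMoment, pow_zero, mul_one, pow_two, gaussianExpectation_X_mul, pderiv_X_self, ← C_1,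
    gaussianExpectation_C, mul_one]

lemma mixedMoment_succ (j : ι) (k : ℕ) :
    mixedMoment v j (k + 1) = (∑ i, (v i : ℝ)) * mixedMoment v j k + 2 * v j * mixedMoment v j k +
      2 * k * ∑ i, v i * gaussianExpectation v (X i ^ 2 * (X j ^ 2 * sqNormPoly ι ^ (k - 1))) := by
  classical
  have h : X j ^ 2 * sqNormPoly ι ^ (k + 1) = ∑ i, X i ^ 2 * (X j ^ 2 * sqNormPoly ι ^ k) := by
    rw [← Finset.sum_mul, pow_succ, sqNormPoly]; ring
  rw [mixedMoment, h, map_sum]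
  rw [Finset.sum_congr rfl fun i _ => gaussianExpectation_X_sq_mul_mixed v i j k]
  simp_rw [mul_add, Finset.sum_add_distrib, Finset.sum_mul, Finset.mul_sum]
  congr 1
  · simp; ring
  · exact Finset.sum_congr rfl fun i _ => by ring

lemma mixedMoment_one (j : ι) : mixedMoment v j 1 = v j * ((∑ i, (v i : ℝ)) + 2 * v j) := by
  rw [mixedMoment_succ, mixedMoment_zero]; simp; ring

lemma variance_le_sum (j : ι) : (v j : ℝ) ≤ ∑ i, (v i : ℝ) :=
  Finset.single_le_sum (f := fun i => (v i : ℝ)) (fun i _ => (v i).2) (Finset.mem_univ j)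

lemma mixedMoment_succ_le (j : ι) (k : ℕ) :
    mixedMoment v j (k + 1) ≤
      ((2 * k + 1) * (∑ i, (v i : ℝ)) + 2 * v j) * mixedMoment v j k := by
  rw [mixedMoment_succ]
  have h : 2 * k * ∑ i, v i * gaussianExpectation v (X i ^ 2 * (X j ^ 2 * sqNormPoly ι ^ (k - 1))) ≤
      2 * k * ((∑ i, (v i : ℝ)) * mixedMoment v j k) := by
    -- At `k = 0` the truncated exponent `k - 1` spoils the resummation over `i`, but the factor `2
    -- * k` is zero.
    rcases k with _ | k
    · simp
    refine mul_le_mul_of_nonneg_left ?_ (by positivity)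
    have h2 : X j ^ 2 * sqNormPoly ι ^ (k + 1) = ∑ i, X i ^ 2 * (X j ^ 2 * sqNormPoly ι ^ k) := by
      rw [← Finset.sum_mul, pow_succ, sqNormPoly]; ring
    rw [mixedMoment, h2, map_sum, Finset.mul_sum]
    refine Finset.sum_le_sum fun i _ => mul_le_mul_of_nonneg_right (variance_le_sum v i) ?_
    refine gaussianExpectation_nonneg v fun y => ?_
    simp only [map_mul, map_pow, eval_X, eval_sqNormPoly]
    positivity
  linarith

/-- The moment with exponent 1 is exact and keeps `t + 2 v_j`; every later step of the recursion
uses `v_j ≤ t`, contributing the factors `5, 7, …, 2k + 3`. Their product is `(2k + 3)‼ / 3`. -/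
lemma three_mul_mixedMoment_succ_le (j : ι) (k : ℕ) :
    3 * mixedMoment v j (k + 1) ≤
      (2 * k + 3)‼ * (∑ i, (v i : ℝ)) ^ k * (v j * ((∑ i, (v i : ℝ)) + 2 * v j)) := by
  have hv := variance_le_sum v j
  have hv0 : (0 : ℝ) ≤ v j := (v j).2
  induction k with
  | zero => simp [mixedMoment_one, Nat.doubleFactorial]
  | succ k ih =>
    have h1 := mixedMoment_succ_le v j (k + 1)
    have h2 := mixedMoment_nonneg v j (k + 1)
    rw [show 2 * (k + 1) + 3 = (2 * k + 3) + 2 by ring, Nat.doubleFactorial_add_two]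
    set t := ∑ i, (v i : ℝ)
    have ht : 0 ≤ t := hv0.trans hv
    calc 3 * mixedMoment v j (k + 1 + 1)
        ≤ 3 * (((2 * (k + 1 : ℕ) + 1) * t + 2 * v j) * mixedMoment v j (k + 1)) := by linarith
      _ ≤ 3 * (((2 * (k + 1 : ℕ) + 1) * t + 2 * t) * mixedMoment v j (k + 1)) := by gcongr
      _ = ((2 * k + 5) * t) * (3 * mixedMoment v j (k + 1)) := by push_cast; ring
      _ ≤ ((2 * k + 5) * t) * ((2 * k + 3)‼ * t ^ k * (v j * (t + 2 * v j))) := by gcongr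
      _ = _ := by push_cast; ring

lemma two_mul_doubleFactorial_le (k : ℕ) : 2 * (2 * k + 3)‼ ≤ 3 * ((k + 2)! * 2 ^ k) := by
  induction k with
  | zero => decide
  | succ k ih =>
    rw [show 2 * (k + 1) + 3 = (2 * k + 3) + 2 by ring, Nat.doubleFactorial_add_two,
      show k + 1 + 2 = (k + 2) + 1 by ring, Nat.factorial_succ, pow_succ]
    calc 2 * ((2 * k + 3 + 2) * (2 * k + 3)‼) = (2 * k + 5) * (2 * (2 * k + 3)‼) := by ring
      _ ≤ (2 * (k + 3)) * (3 * ((k + 2)! * 2 ^ k)) := Nat.mul_le_mul (by omega) ih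
      _ = _ := by ring

lemma succ_mul_doubleFactorial_le (k : ℕ) : (k + 2) * (2 * k + 3)‼ ≤ (k + 3)! * 2 ^ k := by
  induction k with
  | zero => decide
  | succ k ih =>
    rw [show 2 * (k + 1) + 3 = (2 * k + 3) + 2 by ring, Nat.doubleFactorial_add_two,
      show k + 1 + 3 = (k + 3) + 1 by ring, Nat.factorial_succ, pow_succ]
    refine Nat.le_of_mul_le_mul_left (c := k + 2) ?_ (by omega)
    calc (k + 2) * ((k + 1 + 2) * ((2 * k + 3 + 2) * (2 * k + 3)‼))
        = ((k + 3) * (2 * k + 5)) * ((k + 2) * (2 * k + 3)‼) := by ring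
      _ ≤ (2 * (k + 4) * (k + 2)) * ((k + 3)! * 2 ^ k) := Nat.mul_le_mul (by nlinarith) ih
      _ = _ := by ring

/-- `succ_mul_doubleFactorial_le` is an equality at `k = 0` and strict from the next index on.
Between integers this leaves room for 1, which pays for the `t^k` term of even powers. -/
lemma succ_mul_doubleFactorial_lt (k : ℕ) : (k + 3) * (2 * k + 5)‼ < (k + 4)! * 2 ^ (k + 1) := by
  have ih := succ_mul_doubleFactorial_le k
  rw [show 2 * k + 5 = (2 * k + 3) + 2 by ring, Nat.doubleFactorial_add_two,
    show k + 4 = (k + 3) + 1 by ring, Nat.factorial_succ, pow_succ]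
  refine Nat.lt_of_mul_lt_mul_left (a := k + 2) ?_
  calc (k + 2) * ((k + 3) * ((2 * k + 3 + 2) * (2 * k + 3)‼))
      = ((k + 3) * (2 * k + 5)) * ((k + 2) * (2 * k + 3)‼) := by ring
    _ ≤ ((k + 3) * (2 * k + 5)) * ((k + 3)! * 2 ^ k) := by gcongr
    _ < (2 * (k + 4) * (k + 2)) * ((k + 3)! * 2 ^ k) :=
      Nat.mul_lt_mul_of_pos_right (by nlinarith) (by positivity)
    _ = _ := by ring

lemma mixedMoment_succ_le_factorial (j : ι) (k : ℕ) :
    mixedMoment v j (k + 1) ≤ ((k + 2)! : ℝ) / 2 * (2 * ∑ i, (v i : ℝ)) ^ k *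
      (v j * ((∑ i, (v i : ℝ)) + 2 * v j)) := by
  have h := three_mul_mixedMoment_succ_le v j k
  have hv := variance_le_sum v j
  have hv0 : (0 : ℝ) ≤ v j := (v j).2
  set t := ∑ i, (v i : ℝ)
  have ht : 0 ≤ t := hv0.trans hv
  have hn : (2 : ℝ) * (2 * k + 3)‼ ≤ 3 * ((k + 2)! * 2 ^ k) := by
    exact_mod_cast two_mul_doubleFactorial_le k
  have h3 := mul_le_mul_of_nonneg_right hn (show 0 ≤ t ^ k * (v j * (t + 2 * v j)) by positivity)
  rw [mul_pow]
  linarith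

/-! ### Moments of the centred residual. -/

/-- The polynomial `|(y yᵀ - D) eⱼ|² |y|²ᵏ`, with `D` the diagonal matrix of variances. -/
noncomputable def residualPoly (j : ι) (k : ℕ) : MvPolynomial ι ℝ :=
  (X j ^ 2 * sqNormPoly ι - C (2 * v j : ℝ) * X j ^ 2 + C ((v j : ℝ) ^ 2)) * sqNormPoly ι ^ k

lemma gaussianExpectation_residualPoly (j : ι) (k : ℕ) :
    gaussianExpectation v (residualPoly v j k) =
      mixedMoment v j (k + 1) - 2 * v j * mixedMoment v j k +
        v j ^ 2 * gaussianExpectation v (sqNormPoly ι ^ k) := by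
  rw [residualPoly, add_mul, sub_mul, map_add, map_sub, mul_assoc (C _), gaussianExpectation_C_mul,
    gaussianExpectation_C_mul, mul_assoc, ← pow_succ']
  rfl

lemma gaussianExpectation_residualPoly_zero (j : ι) :
    gaussianExpectation v (residualPoly v j 0) = v j * ((∑ i, (v i : ℝ)) + v j) := by
  rw [gaussianExpectation_residualPoly, mixedMoment_one, mixedMoment_zero, pow_zero, ← C_1,
    gaussianExpectation_C]
  ring

lemma gaussianExpectation_residualPoly_succ_le (j : ι) (k : ℕ) :
    gaussianExpectation v (residualPoly v j (k + 1)) ≤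
      (k + 2) * (2 * k + 3)‼ * (∑ i, (v i : ℝ)) ^ (k + 1) *
        (v j * ((∑ i, (v i : ℝ)) + v j)) := by
  have h0 := three_mul_mixedMoment_succ_le v j k
  have h1 := mixedMoment_succ_le v j (k + 1)
  have h2 := mul_gaussianExpectation_sqNormPoly_pow_le v j (k + 1)
  have hv := variance_le_sum v j
  have hv0 : (0 : ℝ) ≤ v j := (v j).2
  rw [gaussianExpectation_residualPoly]
  set t := ∑ i, (v i : ℝ)
  set a : ℝ := (v j : ℝ)
  have ht : 0 ≤ t := hv0.trans hv
  have h3 := mul_le_mul_of_nonneg_left h2 hv0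
  -- This trades `t + 2a` for the smaller `t + a` of the centred bounds. The difference of the two
  -- sides is exactly `(t - a) * ((k + 3) * t + 2 * a)`.
  have h4 : ((2 * k + 3) * t + a) * (t + 2 * a) ≤ 3 * (k + 2) * t * (t + a) := by
    have : 0 ≤ (t - a) * ((k + 3) * t + 2 * a) := mul_nonneg (by linarith) (by positivity)
    linarith
  have h5 := mul_le_mul_of_nonneg_left h0 (show 0 ≤ (2 * k + 3) * t + a by positivity)
  have h6 := mul_le_mul_of_nonneg_left h4 (show 0 ≤ (2 * k + 3)‼ * t ^ k * a by positivity)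
  push_cast at h1
  rw [pow_succ t]
  linarith

lemma gaussianExpectation_residualPoly_le (j : ι) (k : ℕ) :
    gaussianExpectation v (residualPoly v j k) ≤ ((k + 2)! : ℝ) / 2 *
      (2 * ∑ i, (v i : ℝ)) ^ k * (v j * ((∑ i, (v i : ℝ)) + v j)) := by
  rcases k with _ | k
  · rw [gaussianExpectation_residualPoly_zero]; simp
  have h := gaussianExpectation_residualPoly_succ_le v j k
  have hv := variance_le_sum v j
  have hv0 : (0 : ℝ) ≤ v j := (v j).2
  set t := ∑ i, (v i : ℝ)
  have ht : 0 ≤ t := hv0.trans hv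
  have hn : ((k : ℝ) + 2) * (2 * k + 3)‼ ≤ (k + 3)! * 2 ^ k := by
    exact_mod_cast succ_mul_doubleFactorial_le k
  have h3 := mul_le_mul_of_nonneg_right hn
    (show 0 ≤ t ^ (k + 1) * (v j * (t + v j)) by positivity)
  rw [mul_pow, pow_succ 2]
  linarith

lemma gaussianExpectation_residualPoly_add_le (j : ι) {k : ℕ} (hk : 2 ≤ k) :
    gaussianExpectation v (residualPoly v j k) +
      (∑ i, (v i : ℝ)) ^ k * gaussianExpectation v (residualPoly v j 0) ≤ ((k + 2)! : ℝ) / 2 *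
      (2 * ∑ i, (v i : ℝ)) ^ k * (v j * ((∑ i, (v i : ℝ)) + v j)) := by
  obtain ⟨k, rfl⟩ := Nat.exists_eq_add_of_le' hk
  have h := gaussianExpectation_residualPoly_succ_le v j (k + 1)
  rw [gaussianExpectation_residualPoly_zero]
  have hv := variance_le_sum v j
  have hv0 : (0 : ℝ) ≤ v j := (v j).2
  set t := ∑ i, (v i : ℝ)
  have ht : 0 ≤ t := hv0.trans hv
  have hn : ((k : ℝ) + 3) * (2 * k + 5)‼ + 1 ≤ (k + 4)! * 2 ^ (k + 1) := by
    exact_mod_cast succ_mul_doubleFactorial_lt k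
  have h3 := mul_le_mul_of_nonneg_right hn
    (show 0 ≤ t ^ (k + 2) * (v j * (t + v j)) by positivity)
  rw [mul_pow, pow_succ 2]
  push_cast at h
  rw [show 2 * (k + 1) + 3 = 2 * k + 5 by ring, show k + 1 + 1 = k + 2 by ring] at h
  rw [show k + 2 + 2 = k + 4 by ring]
  linarith

end

/-! ### Loewner bounds for powers of a symmetric matrix. -/

section

open Matrix

variable {n : Type*} [Fintype n] [DecidableEq n]

lemma pow_le_pow_add_pow_of_even {r t x : ℝ} (hx : x ≤ r) (htx : -t ≤ x) (hr : 0 ≤ r) (ht : 0 ≤ t)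
    {k : ℕ} (hk : Even k) : x ^ k ≤ r ^ k + t ^ k := by
  rcases le_total 0 x with h | h
  · have := pow_le_pow_left₀ h hx k
    have := pow_nonneg ht k
    linarith
  · have := pow_le_pow_left₀ (neg_nonneg.2 h) (neg_le.1 htx) k
    rw [hk.neg_pow] at this
    have := pow_nonneg hr k
    linarith

lemma Matrix.IsHermitian.pow_le_algebraMap {M : Matrix n n ℝ} (hM : M.IsHermitian) {c : ℝ} (k : ℕ)
    (h : ∀ x ∈ spectrum ℝ M, x ^ k ≤ c) : M ^ k ≤ algebraMap ℝ _ c := by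
  have hM' : IsSelfAdjoint M := hM
  rw [← cfc_pow_id (R := ℝ) M k]
  exact cfc_le_algebraMap _ _ _ h

lemma Matrix.IsHermitian.pow_le_of_odd {M : Matrix n n ℝ} (hM : M.IsHermitian) {r : ℝ}
    (hr : M ≤ algebraMap ℝ _ r) {k : ℕ} (hk : Odd k) : M ^ k ≤ algebraMap ℝ _ (r ^ k) := by
  have hM' : IsSelfAdjoint M := hM
  exact hM.pow_le_algebraMap k fun x hx =>
    hk.pow_le_pow.2 ((le_algebraMap_iff_spectrum_le (a := M)).1 hr x hx)

lemma Matrix.IsHermitian.pow_le_of_even {M : Matrix n n ℝ} (hM : M.IsHermitian) {r t : ℝ}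
    (hr : M ≤ algebraMap ℝ _ r) (ht : -M ≤ algebraMap ℝ _ t) (hr0 : 0 ≤ r) (ht0 : 0 ≤ t)
    {k : ℕ} (hk : Even k) : M ^ k ≤ algebraMap ℝ _ (r ^ k + t ^ k) := by
  have hM' : IsSelfAdjoint M := hM
  refine hM.pow_le_algebraMap k fun x hx => pow_le_pow_add_pow_of_even
    ((le_algebraMap_iff_spectrum_le (a := M)).1 hr x hx) ?_ hr0 ht0 hk
  refine (algebraMap_le_iff_le_spectrum (a := M)).1 ?_ x hx
  rw [map_neg]
  exact neg_le.1 ht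

/-- Conjugation by `M` preserves the Loewner order: sandwich `M ^ k ≤ c` between two copies of `M`
and read off a diagonal entry. -/
lemma Matrix.IsHermitian.pow_add_two_apply_self_le {M : Matrix n n ℝ} (hM : M.IsHermitian) {c : ℝ}
    {k : ℕ} (h : M ^ k ≤ algebraMap ℝ _ c) (j : n) :
    (M ^ (k + 2)) j j ≤ c * (M ^ 2) j j := by
  have hM' : IsSelfAdjoint M := hM
  have h1 := hM'.conjugate_le_conjugate h
  have h2 := (Matrix.le_iff.1 h1).diag_nonneg (i := j)
  have e1 : M * M ^ k * M = M ^ (k + 2) := by rw [← pow_succ', ← pow_succ]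
  have e2 : M * algebraMap ℝ _ c * M = c • M ^ 2 := by
    rw [Algebra.algebraMap_eq_smul_one, mul_smul_comm, smul_mul_assoc, mul_one, pow_two]
  rw [e1, e2] at h2
  simpa using h2

/-- As quadratic forms, this is Cauchy–Schwarz. -/
lemma vecMulVec_self_le_algebraMap (y : n → ℝ) :
    vecMulVec y y ≤ algebraMap ℝ _ (∑ i, y i ^ 2) := by
  rw [Matrix.le_iff]
  refine PosSemidef.of_dotProduct_mulVec_nonneg ?_ fun x => ?_
  · rw [Algebra.algebraMap_eq_smul_one]
    ext i j
    simp [vecMulVec_apply, mul_comm, one_apply, eq_comm]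
  · have h := Finset.sum_mul_sq_le_sq_mul_sq Finset.univ y x
    rw [sub_mulVec, dotProduct_sub, vecMulVec_mulVec, Algebra.algebraMap_eq_smul_one, smul_mulVec,
      one_mulVec]
    simp only [star_trivial, op_smul_eq_smul, dotProduct_smul, smul_eq_mul]
    simp only [dotProduct]
    have e1 : ∑ i, x i * y i = ∑ i, y i * x i := by simp_rw [mul_comm]
    have e2 : ∑ i, x i * x i = ∑ i, x i ^ 2 := by simp_rw [pow_two]
    rw [e1, e2, ← pow_two]
    linarith

lemma vecMulVec_self_nonneg {n : Type*} [Finite n] (y : n → ℝ) : 0 ≤ vecMulVec y y := by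
  simpa using (posSemidef_vecMulVec_self_star y).nonneg

lemma diagonal_le_algebraMap_sum (v : n → ℝ≥0) :
    diagonal (fun i => (v i : ℝ)) ≤ algebraMap ℝ _ (∑ i, (v i : ℝ)) := by
  rw [Matrix.le_iff, Algebra.algebraMap_eq_smul_one, smul_one_eq_diagonal, diagonal_sub,
    posSemidef_diagonal_iff]
  exact fun i => sub_nonneg.2 (variance_le_sum v i)

lemma diagonal_coe_nonneg {n : Type*} [DecidableEq n] (v : n → ℝ≥0) : 0 ≤ diagonal (fun i => (v i : ℝ)) :=
  (PosSemidef.diagonal fun i => (v i).2).nonneg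

lemma vecMulVec_sub_diagonal_le (v : n → ℝ≥0) (y : n → ℝ) :
    vecMulVec y y - diagonal (fun i => (v i : ℝ)) ≤ algebraMap ℝ _ (∑ i, y i ^ 2) :=
  (sub_le_self _ (diagonal_coe_nonneg v)).trans (vecMulVec_self_le_algebraMap y)

lemma diagonal_sub_vecMulVec_le (v : n → ℝ≥0) (y : n → ℝ) :
    diagonal (fun i => (v i : ℝ)) - vecMulVec y y ≤ algebraMap ℝ _ (∑ i, (v i : ℝ)) :=
  (sub_le_self _ (vecMulVec_self_nonneg y)).trans (diagonal_le_algebraMap_sum v)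

lemma isHermitian_vecMulVec_sub_diagonal {n : Type*} [Finite n] [DecidableEq n]
    (v : n → ℝ≥0) (y : n → ℝ) :
    (vecMulVec y y - diagonal (fun i => (v i : ℝ))).IsHermitian :=
  (vecMulVec_self_nonneg y).posSemidef.isHermitian.sub
    (diagonal_coe_nonneg v).posSemidef.isHermitian

lemma vecMulVec_self_pow_succ (y : n → ℝ) (k : ℕ) :
    vecMulVec y y ^ (k + 1) = (∑ i, y i ^ 2) ^ k • vecMulVec y y := by
  induction k with
  | zero => simp
  | succ k ih =>
    rw [pow_succ, ih, smul_mul_assoc, vecMulVec_mul_vecMulVec, pow_succ, mul_smul]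
    congr 2
    simp [dotProduct, pow_two, vecMulVec_smul]

lemma vecMulVec_sub_diagonal_sq_apply_self (v : n → ℝ≥0) (y : n → ℝ) (j : n) :
    ((vecMulVec y y - diagonal (fun i => (v i : ℝ))) ^ 2) j j =
      MvPolynomial.eval y (residualPoly v j 0) := by
  have h : (vecMulVec y y * vecMulVec y y) j j = (∑ i, y i ^ 2) * (y j * y j) := by
    rw [← pow_two, vecMulVec_self_pow_succ]; simp [vecMulVec_apply]
  rw [pow_two, sub_mul, mul_sub, mul_sub, Matrix.sub_apply, Matrix.sub_apply,
    Matrix.sub_apply, h]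
  simp [residualPoly, vecMulVec_apply]
  ring

end

/-! ### Expected powers in diagonal coordinates. -/

section

open Matrix MvPolynomial

variable {n : Type*} [Fintype n] [DecidableEq n]

/-- The power can be taken over the polynomial ring before evaluating. This supplies integrability
and continuity of every entry at once. -/
lemma exists_eval_eq_pow_apply (a : ℝ) (w : n → ℝ) (p : ℕ) (i j : n) :
    ∃ f : MvPolynomial n ℝ, ∀ y, ((a • vecMulVec y y + diagonal w) ^ p) i j = eval y f := by
  let N : Matrix n n (MvPolynomial n ℝ) := (C a : MvPolynomial n ℝ) •
    vecMulVec (fun i => X i) (fun i => X i) + diagonal fun i => C (w i)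
  refine ⟨(N ^ p) i j, fun y => ?_⟩
  have h : a • vecMulVec y y + diagonal w = N.map (eval y) := by
    ext k l
    simp [N, vecMulVec_apply, diagonal_apply, apply_ite (eval y)]
  rw [h, ← RingHom.mapMatrix_apply, ← map_pow]
  rfl

lemma conj_pow_of_mul_eq_one {R : Type*} [Monoid R] {a b : R} (hab : a * b = 1) (hba : b * a = 1)
    (x : R) (p : ℕ) : (a * x * b) ^ p = a * x ^ p * b := by
  let u : Rˣ := ⟨a, b, hab, hba⟩
  exact Units.conj_pow u x p

lemma measurePreserving_sign_flip (v : n → ℝ≥0) (i : n) :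
    MeasurePreserving (fun (y : n → ℝ) l => if l = i then -y l else y l)
      (piGaussian v) (piGaussian v) := by
  refine measurePreserving_pi _ _ (f := fun l x => if l = i then -x else x) fun l => ?_
  by_cases h : l = i
  · simp only [h, if_true]
    exact ⟨measurable_neg, by simpa using gaussianReal_map_neg (μ := 0) (v := v i)⟩
  · simp only [h, if_false]
    exact MeasurePreserving.id _

/-- Negating `y i` preserves the measure and conjugates the matrix by a diagonal sign matrix, which
negates the `(i, j)` entry of every power. -/
lemma integral_pow_apply_of_ne (v : n → ℝ≥0) (a : ℝ) (w : n → ℝ) (p : ℕ) {i j : n} (hij : i ≠ j) :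
    ∫ y, ((a • vecMulVec y y + diagonal w) ^ p) i j ∂piGaussian v = 0 := by
  obtain ⟨f, hf⟩ := exists_eval_eq_pow_apply a w p i j
  have hmp := measurePreserving_sign_flip v i
  set flip := fun (y : n → ℝ) l => if l = i then -y l else y l with hflip
  let D : Matrix n n ℝ := diagonal fun l => if l = i then -1 else 1
  have hD : D * D = 1 := by
    rw [diagonal_mul_diagonal, ← diagonal_one]
    congr 1; ext l; split_ifs <;> simp
  have hflip (y : n → ℝ) : ((a • vecMulVec (flip y) (flip y) + diagonal w) ^ p) i j =
      -((a • vecMulVec y y + diagonal w) ^ p) i j := by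
    have h : a • vecMulVec (flip y) (flip y) + diagonal w =
        D * (a • vecMulVec y y + diagonal w) * D := by
      ext k l
      simp only [D, mul_diagonal, diagonal_mul, Matrix.add_apply, Matrix.smul_apply, vecMulVec_apply, hflip,
        diagonal_apply, smul_eq_mul]
      split_ifs <;> simp_all
    rw [h, conj_pow_of_mul_eq_one hD hD]
    simp [D, mul_diagonal, diagonal_mul, hij.symm]
  simp_rw [hf] at hflip ⊢
  have hflip_int : ∫ y, eval y f ∂piGaussian v = ∫ y, eval (flip y) f ∂piGaussian v := by
    conv_lhs => rw [← hmp.map_eq]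
    exact integral_map hmp.measurable.aemeasurable
      (MvPolynomial.continuous_eval f).aestronglyMeasurable
  simp_rw [hflip, integral_neg] at hflip_int
  linarith

lemma integral_vecMulVec_pow_apply_self_le (v : n → ℝ≥0) (k : ℕ) (j : n) :
    ∫ y, (vecMulVec y y ^ (k + 2)) j j ∂piGaussian v ≤ ((k + 2)! : ℝ) / 2 *
      (2 * ∑ i, (v i : ℝ)) ^ k * (v j * ((∑ i, (v i : ℝ)) + 2 * v j)) := by
  refine le_trans (le_of_eq ?_) (mixedMoment_succ_le_factorial v j k)
  rw [mixedMoment, gaussianExpectation_apply]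
  refine integral_congr_ae (Filter.Eventually.of_forall fun y => ?_)
  simp only
  rw [vecMulVec_self_pow_succ]
  simp [vecMulVec_apply]
  ring

lemma integral_pow_apply_le {v : n → ℝ≥0} {a : ℝ} {w : n → ℝ} {p : ℕ} {j : n}
    {f : MvPolynomial n ℝ} (h : ∀ y, ((a • vecMulVec y y + diagonal w) ^ p) j j ≤ eval y f) :
    ∫ y, ((a • vecMulVec y y + diagonal w) ^ p) j j ∂piGaussian v ≤ gaussianExpectation v f := by
  obtain ⟨g, hg⟩ := exists_eval_eq_pow_apply a w p j j
  simp_rw [hg] at h ⊢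
  exact gaussianExpectation_mono v h

lemma eval_residualPoly {n : Type*} [Fintype n] (v : n → ℝ≥0) (j : n) (k : ℕ) (y : n → ℝ) :
    eval y (residualPoly v j k) = (∑ i, y i ^ 2) ^ k * eval y (residualPoly v j 0) := by
  simp [residualPoly, mul_comm]

lemma integral_centered_pow_apply_self_le (v : n → ℝ≥0) (k : ℕ) (j : n) :
    ∫ y, (((1 : ℝ) • vecMulVec y y + diagonal fun i => -(v i : ℝ)) ^ (k + 2)) j j ∂piGaussian v ≤
      ((k + 2)! : ℝ) / 2 * (2 * ∑ i, (v i : ℝ)) ^ k * (v j * ((∑ i, (v i : ℝ)) + v j)) := by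
  have e (y : n → ℝ) : (1 : ℝ) • vecMulVec y y + diagonal (fun i => -(v i : ℝ)) =
      vecMulVec y y - diagonal fun i => (v i : ℝ) := by
    rw [one_smul, sub_eq_add_neg, diagonal_neg]
  have hr (y : n → ℝ) : 0 ≤ ∑ i, y i ^ 2 := Finset.sum_nonneg fun i _ => sq_nonneg _
  have ht : 0 ≤ ∑ i, (v i : ℝ) := Finset.sum_nonneg fun i _ => (v i).2
  rcases Nat.even_or_odd k with hk | hk
  -- For `k = 0` the even bound `|y|^(2k) + t^k` equals 2 and would double the estimate, so `M²` is
  -- evaluated exactly.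
  · rcases Nat.eq_zero_or_pos k with rfl | hk0
    · refine (integral_pow_apply_le fun y => ?_).trans (gaussianExpectation_residualPoly_le v j 0)
      rw [e, vecMulVec_sub_diagonal_sq_apply_self]
    have hk2 : 2 ≤ k := by rcases hk with ⟨m, rfl⟩; omega
    refine le_trans ?_ (gaussianExpectation_residualPoly_add_le v j hk2)
    rw [← gaussianExpectation_C_mul, ← map_add]
    refine integral_pow_apply_le fun y => ?_
    rw [e]
    refine ((isHermitian_vecMulVec_sub_diagonal v y).pow_add_two_apply_self_le
      ((isHermitian_vecMulVec_sub_diagonal v y).pow_le_of_even (vecMulVec_sub_diagonal_le v y)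
        (by rw [neg_sub]; exact diagonal_sub_vecMulVec_le v y) (hr y) ht hk) j).trans_eq ?_
    rw [vecMulVec_sub_diagonal_sq_apply_self, map_add, map_mul, eval_C, eval_residualPoly v j k]
    ring
  · refine (integral_pow_apply_le fun y => ?_).trans (gaussianExpectation_residualPoly_le v j k)
    rw [e]
    refine ((isHermitian_vecMulVec_sub_diagonal v y).pow_add_two_apply_self_le
      ((isHermitian_vecMulVec_sub_diagonal v y).pow_le_of_odd
        (vecMulVec_sub_diagonal_le v y) hk) j).trans_eq ?_
    rw [vecMulVec_sub_diagonal_sq_apply_self, eval_residualPoly v j k]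

/-- Even powers do not see the sign. For odd `k`, `-M ≤ t` bounds the middle factor by the
deterministic `t ^ k`, so only the second moment is needed. -/
lemma integral_neg_centered_pow_apply_self_le (v : n → ℝ≥0) (k : ℕ) (j : n) :
    ∫ y, (((-1 : ℝ) • vecMulVec y y + diagonal fun i => (v i : ℝ)) ^ (k + 2)) j j ∂piGaussian v ≤
      ((k + 2)! : ℝ) / 2 * (2 * ∑ i, (v i : ℝ)) ^ k * (v j * ((∑ i, (v i : ℝ)) + v j)) := by
  have e (y : n → ℝ) : (-1 : ℝ) • vecMulVec y y + diagonal (fun i => (v i : ℝ)) =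
      -((1 : ℝ) • vecMulVec y y + diagonal fun i => -(v i : ℝ)) := by
    rw [neg_add, ← diagonal_neg]; simp
  have e' (y : n → ℝ) : (-1 : ℝ) • vecMulVec y y + diagonal (fun i => (v i : ℝ)) =
      -(vecMulVec y y - diagonal fun i => (v i : ℝ)) := by
    simp [sub_eq_neg_add]
  have ht : 0 ≤ ∑ i, (v i : ℝ) := Finset.sum_nonneg fun i _ => (v i).2
  have hv : (0 : ℝ) ≤ v j := (v j).2
  rcases Nat.even_or_odd k with hk | hk
  · simp_rw [e, (hk.add even_two).neg_pow]
    exact integral_centered_pow_apply_self_le v k j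
  · have h : ∫ y, (((-1 : ℝ) • vecMulVec y y + diagonal fun i => (v i : ℝ)) ^ (k + 2)) j j
        ∂piGaussian v ≤ gaussianExpectation v (C ((∑ i, (v i : ℝ)) ^ k) * residualPoly v j 0) := by
      refine integral_pow_apply_le fun y => ?_
      rw [e']
      refine ((isHermitian_vecMulVec_sub_diagonal v y).neg.pow_add_two_apply_self_le
        ((isHermitian_vecMulVec_sub_diagonal v y).neg.pow_le_of_odd
          (by rw [neg_sub]; exact diagonal_sub_vecMulVec_le v y) hk) j).trans_eq ?_
      rw [neg_sq, vecMulVec_sub_diagonal_sq_apply_self, map_mul, eval_C]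
    refine h.trans ?_
    rw [gaussianExpectation_C_mul, gaussianExpectation_residualPoly_zero]
    refine mul_le_mul_of_nonneg_right ?_ (by positivity)
    have hn : (2 : ℝ) ≤ (k + 2)! := by
      exact_mod_cast (Nat.le_add_left 2 k).trans (Nat.self_le_factorial _)
    calc (∑ i, (v i : ℝ)) ^ k = 1 * (1 * ∑ i, (v i : ℝ)) ^ k := by simp
      _ ≤ (k + 2)! / 2 * (2 * ∑ i, (v i : ℝ)) ^ k := by
        gcongr
        · linarith
        · norm_num

end

/-! ### Reduction to a diagonal covariance. -/

section

open Matrix WithLp Complex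

/-- Both characteristic functions are exponentials of the same quadratic form, `xᵀ C x = ∑ v_i (Uᵀ
x)_i²`. -/
lemma multivariateGaussian_eq_map_piGaussian {n : Type*} [Fintype n] [DecidableEq n]
    {C : Matrix n n ℝ} (hC : C.PosSemidef) {U : Matrix n n ℝ} {v : n → ℝ≥0}
    (h : C = U * diagonal (fun i => (v i : ℝ)) * Uᵀ) :
    multivariateGaussian 0 C = (piGaussian v).map (fun y => toLp 2 (U *ᵥ y)) := by
  have hmeas : Measurable fun y : n → ℝ => toLp 2 (U *ᵥ y) := by fun_prop
  have : IsProbabilityMeasure ((piGaussian v).map (fun y => toLp 2 (U *ᵥ y))) :=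
    Measure.isProbabilityMeasure_map hmeas.aemeasurable
  refine Measure.ext_of_charFun ?_
  ext x
  have hinner (y : n → ℝ) : inner ℝ (toLp 2 (U *ᵥ y)) x =
      inner ℝ (toLp 2 y) (toLp 2 (Uᵀ *ᵥ x.ofLp)) := by
    simp only [EuclideanSpace.inner_eq_star_dotProduct, star_trivial]
    rw [dotProduct_mulVec, mulVec_transpose]
  have hmap : charFun ((piGaussian v).map fun y => toLp 2 (U *ᵥ y)) x =
      charFun ((piGaussian v).map (toLp 2)) (toLp 2 (Uᵀ *ᵥ x.ofLp)) := by
    rw [charFun_apply, charFun_apply, integral_map hmeas.aemeasurable (by fun_prop),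
      integral_map (by fun_prop) (by fun_prop)]
    simp_rw [hinner]
  rw [hmap, charFun_multivariateGaussian hC, charFun_pi]
  simp_rw [charFun_gaussianReal, ← exp_sum]
  congr 1
  have hq : x.ofLp ⬝ᵥ C *ᵥ x.ofLp = ∑ i, (v i : ℝ) * (Uᵀ *ᵥ x.ofLp) i ^ 2 := by
    rw [h, ← mulVec_mulVec, ← mulVec_mulVec, dotProduct_mulVec, ← mulVec_transpose]
    simp only [dotProduct, mulVec_diagonal]
    exact Finset.sum_congr rfl fun i _ => by ring
  rw [hq]
  simp [Finset.sum_div, Finset.sum_neg_distrib]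

lemma Matrix.PosSemidef.exists_diagonalization {n : Type*} [Fintype n] [DecidableEq n]
    {C : Matrix n n ℝ} (hC : C.PosSemidef) :
    ∃ (U : Matrix n n ℝ) (v : n → ℝ≥0), U * Uᵀ = 1 ∧ Uᵀ * U = 1 ∧
      C = U * diagonal (fun i => (v i : ℝ)) * Uᵀ := by
  refine ⟨hC.isHermitian.eigenvectorUnitary,
    fun i => ⟨hC.isHermitian.eigenvalues i, hC.eigenvalues_nonneg i⟩, ?_, ?_, ?_⟩
  · simpa [star_eq_conjTranspose] using
      Unitary.coe_mul_star_self hC.isHermitian.eigenvectorUnitary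
  · simpa [star_eq_conjTranspose] using
      Unitary.coe_star_mul_self hC.isHermitian.eigenvectorUnitary
  · simpa [Unitary.conjStarAlgAut_apply, star_eq_conjTranspose, Function.comp_def] using!
      hC.isHermitian.spectral_theorem

variable {d : ℕ}

/-- Expectation commutes with conjugation by the constant `U`. As `E N` is diagonal, its entrywise
bound is a Loewner bound, which conjugation preserves. -/
lemma matrixExpectation_le_of_conj {Ω : Type*} [MeasurableSpace Ω] {P : Measure Ω}
    {C : Matrix (Fin d) (Fin d) ℝ} (hC : C.PosSemidef)
    {U : Matrix (Fin d) (Fin d) ℝ} {v : Fin d → ℝ≥0}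
    (h : C = U * diagonal (fun i => (v i : ℝ)) * Uᵀ)
    {ξ : Ω → EuclideanSpace ℝ (Fin d)} (hξ : HasLaw ξ (multivariateGaussian 0 C) P)
    {M : EuclideanSpace ℝ (Fin d) → Matrix (Fin d) (Fin d) ℝ} (hM : Continuous M)
    {N : (Fin d → ℝ) → Matrix (Fin d) (Fin d) ℝ}
    (hMN : ∀ y, M (toLp 2 (U *ᵥ y)) = U * N y * Uᵀ)
    (hint : ∀ i j, Integrable (fun y => N y i j) (piGaussian v))
    (hoff : ∀ i j, i ≠ j → ∫ y, N y i j ∂piGaussian v = 0)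
    {b : Fin d → ℝ} (hb : ∀ j, ∫ y, N y j j ∂piGaussian v ≤ b j) :
    MatrixIntegrable (fun ω => M (ξ ω)) P ∧
      matrixExpectation (fun ω => M (ξ ω)) P ≤ U * diagonal b * Uᵀ := by
  have hlaw := multivariateGaussian_eq_map_piGaussian hC h
  have hmeas : Measurable fun y : Fin d → ℝ => toLp 2 (U *ᵥ y) := by fun_prop
  have hMc (i j : Fin d) : Continuous fun x => M x i j := hM.matrix_elem i j
  have hentry (y : Fin d → ℝ) (i j : Fin d) :
      M (toLp 2 (U *ᵥ y)) i j = ∑ l, ∑ k, U i k * N y k l * U j l := by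
    rw [hMN]
    simp [mul_apply, Finset.sum_mul]
  have hintM (i j : Fin d) : Integrable (fun x => M x i j) (multivariateGaussian 0 C) := by
    rw [hlaw, integrable_map_measure (hMc i j).aestronglyMeasurable hmeas.aemeasurable]
    simp only [Function.comp_def, hentry]
    exact integrable_finsetSum _ fun l _ => integrable_finsetSum _ fun k _ =>
      ((hint k l).const_mul _).mul_const _
  refine ⟨fun i j => ?_, ?_⟩
  · have := hintM i j
    rw [← hξ.map_eq, integrable_map_measure (hMc i j).aestronglyMeasurable hξ.aemeasurable] at this
    exact this
  have hexp : matrixExpectation (fun ω => M (ξ ω)) P =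
      U * diagonal (fun j => ∫ y, N y j j ∂piGaussian v) * Uᵀ := by
    ext i j
    have h1 : ∫ ω, M (ξ ω) i j ∂P = ∫ y, M (toLp 2 (U *ᵥ y)) i j ∂piGaussian v := by
      rw [← integral_map hmeas.aemeasurable (f := fun x => M x i j)
        (hMc i j).aestronglyMeasurable, ← hlaw, ← hξ.map_eq,
        integral_map hξ.aemeasurable (hMc i j).aestronglyMeasurable]
    rw [matrixExpectation, of_apply, h1]
    simp_rw [hentry]
    rw [integral_finsetSum _ fun l _ => integrable_finsetSum _ fun k _ =>
      ((hint k l).const_mul _).mul_const _]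
    simp only [mul_apply, diagonal_apply, transpose_apply, Finset.sum_mul]
    refine Finset.sum_congr rfl fun l _ => ?_
    rw [integral_finsetSum _ fun k _ => ((hint k l).const_mul _).mul_const _]
    refine Finset.sum_congr rfl fun k _ => ?_
    rw [integral_mul_const, integral_const_mul]
    by_cases hkl : k = l
    · subst hkl; simp
    · simp [hkl, hoff k l hkl]
  rw [hexp, Matrix.le_iff, ← sub_mul, ← mul_sub, diagonal_sub]
  have hpos : (diagonal fun j => b j - ∫ y, N y j j ∂piGaussian v).PosSemidef :=
    PosSemidef.diagonal fun j => sub_nonneg.2 (hb j)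
  simpa using hpos.mul_mul_conjTranspose_same U

lemma outerSelf_toLp_mulVec (U : Matrix (Fin d) (Fin d) ℝ) (y : Fin d → ℝ) :
    outerSelf (toLp 2 (U *ᵥ y)) = U * vecMulVec y y * Uᵀ := by
  rw [mul_vecMulVec, vecMulVec_mul, vecMul_transpose]
  rfl

lemma continuous_outerSelf : Continuous (outerSelf (d := d)) := by
  unfold outerSelf
  fun_prop

/-- The pairs `(a, c) = (1, 0), (1, -1), (-1, 1)` give the three matrices of the theorem. -/
lemma matrixExpectation_pow_le {Ω : Type*} [MeasurableSpace Ω] {P : Measure Ω}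
    {C : Matrix (Fin d) (Fin d) ℝ} (hC : C.PosSemidef)
    {U : Matrix (Fin d) (Fin d) ℝ} {v : Fin d → ℝ≥0} (hU : U * Uᵀ = 1) (hU' : Uᵀ * U = 1)
    (h : C = U * diagonal (fun i => (v i : ℝ)) * Uᵀ)
    {ξ : Ω → EuclideanSpace ℝ (Fin d)} (hξ : HasLaw ξ (multivariateGaussian 0 C) P)
    (a c : ℝ) (p : ℕ) {b : Fin d → ℝ}
    (hb : ∀ j, ∫ y, ((a • vecMulVec y y + diagonal fun i => c * v i) ^ p) j j ∂piGaussian v ≤ b j) :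
    MatrixIntegrable (fun ω => (a • outerSelf (ξ ω) + c • C) ^ p) P ∧
      matrixExpectation (fun ω => (a • outerSelf (ξ ω) + c • C) ^ p) P ≤
        U * diagonal b * Uᵀ := by
  refine matrixExpectation_le_of_conj hC h hξ (M := fun x => (a • outerSelf x + c • C) ^ p)
    (((continuous_outerSelf.const_smul a).add continuous_const).pow p)
    (N := fun y => (a • vecMulVec y y + diagonal fun i => c * v i) ^ p) (fun y => ?_)
    (fun i j => ?_) (fun i j hij => integral_pow_apply_of_ne v a _ p hij) hb
  · have hd : diagonal (fun i => c * (v i : ℝ)) = c • diagonal fun i => (v i : ℝ) := by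
      rw [← diagonal_smul]; rfl
    rw [outerSelf_toLp_mulVec, ← conj_pow_of_mul_eq_one hU hU', h, hd]
    simp only [mul_add, add_mul, mul_smul_comm, smul_mul_assoc]
  · obtain ⟨f, hf⟩ := exists_eval_eq_pow_apply a (fun i => c * v i) p i j
    simp_rw [hf]
    exact integrable_eval_piGaussian v f

lemma smul_trace_smul_add_eq_conj {n : Type*} [Fintype n] [DecidableEq n] {C U : Matrix n n ℝ}
    {v : n → ℝ} (hU : Uᵀ * U = 1) (h : C = U * diagonal v * Uᵀ) (c s : ℝ) (k : ℕ) :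
    (c * (2 * C.trace) ^ k) • (C.trace • C + s • C ^ 2) =
      U * diagonal (fun j => c * (2 * ∑ i, v i) ^ k * (v j * ((∑ i, v i) + s * v j))) * Uᵀ := by
  have ht : C.trace = ∑ i, v i := by
    rw [h, trace_mul_comm, ← mul_assoc, hU, one_mul, trace_diagonal]
  have hd : diagonal (fun j => c * (2 * ∑ i, v i) ^ k * (v j * ((∑ i, v i) + s * v j))) =
      (c * (2 * ∑ i, v i) ^ k) • ((∑ i, v i) • diagonal v + s • diagonal v ^ 2) := by
    ext i j
    rw [diagonal_pow]
    by_cases hij : i = j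
    · subst hij
      simp only [diagonal_apply_eq, Matrix.smul_apply, Matrix.add_apply, Pi.pow_apply, smul_eq_mul]
      ring
    · simp [hij]
  have hsq : C ^ 2 = U * diagonal v ^ 2 * Uᵀ := by
    rw [h, pow_two, pow_two]
    calc U * diagonal v * Uᵀ * (U * diagonal v * Uᵀ)
        = U * diagonal v * (Uᵀ * U) * diagonal v * Uᵀ := by simp only [mul_assoc]
      _ = _ := by rw [hU, mul_one]; simp only [mul_assoc]
  rw [ht, hd, hsq]
  nth_rw 1 [h]
  simp only [mul_add, add_mul, mul_smul_comm, smul_mul_assoc]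

end

/-- Here `≤` between matrices is the Loewner order: `A ≤ B` iff `B - A` is positive
semidefinite. -/
theorem lemma3 {Ω : Type*} [MeasurableSpace Ω] (P : Measure Ω) [IsProbabilityMeasure P]
    (d : ℕ) (C : Matrix (Fin d) (Fin d) ℝ) (hC : C.PosSemidef)
    (ξ : Ω → EuclideanSpace ℝ (Fin d)) (hξ : HasLaw ξ (multivariateGaussian 0 C) P)
    (p : ℕ) (hp : 2 ≤ p) :
    (MatrixIntegrable (fun ω => outerSelf (ξ ω) ^ p) P ∧
      matrixExpectation (fun ω => outerSelf (ξ ω) ^ p) P ≤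
        ((p ! : ℝ) / 2 * (2 * C.trace) ^ (p - 2)) • (C.trace • C + (2 : ℝ) • C ^ 2)) ∧
    (MatrixIntegrable (fun ω => (outerSelf (ξ ω) - C) ^ p) P ∧
      matrixExpectation (fun ω => (outerSelf (ξ ω) - C) ^ p) P ≤
        ((p ! : ℝ) / 2 * (2 * C.trace) ^ (p - 2)) • (C.trace • C + C ^ 2)) ∧
    (MatrixIntegrable (fun ω => (C - outerSelf (ξ ω)) ^ p) P ∧
      matrixExpectation (fun ω => (C - outerSelf (ξ ω)) ^ p) P ≤
        ((p ! : ℝ) / 2 * (2 * C.trace) ^ (p - 2)) • (C.trace • C + C ^ 2)) := by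
  obtain ⟨U, v, hU, hU', h⟩ := hC.exists_diagonalization
  obtain ⟨k, rfl⟩ := Nat.exists_eq_add_of_le' hp
  -- The conjugation formula is used with `s = 2` for the uncentred bound and `s = 1` for the two
  -- centred ones.
  rw [Nat.add_sub_cancel, smul_trace_smul_add_eq_conj hU' h, ← one_smul ℝ (C ^ 2),
    smul_trace_smul_add_eq_conj hU' h]
  refine ⟨?_, ?_, ?_⟩
  · simpa using matrixExpectation_pow_le hC hU hU' h hξ 1 0 (k + 2) fun j => by
      simpa using integral_vecMulVec_pow_apply_self_le v k j
  · simpa [sub_eq_add_neg] using matrixExpectation_pow_le hC hU hU' h hξ 1 (-1) (k + 2) fun j => by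
      simpa using integral_centered_pow_apply_self_le v k j
  · simpa [sub_eq_neg_add] using matrixExpectation_pow_le hC hU hU' h hξ (-1) 1 (k + 2) fun j => by
      simpa using integral_neg_centered_pow_apply_self_le v k j
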